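/- Let $\boldsymbol a=(a_0,a_1,a_2,\dots)$ be a sequence of natural numbers with $a_j>1$ for all $j$. Let $\Delta_{\boldsymbol a}$ be the topological group of $\boldsymbol a$-adic integers (the product $\prod_{n\ge 0}\{0,1,\dots,a_n-1\}$ with the product topology and addition with carry), let $u=(1,0,0,\dots)\in\Delta_{\boldsymbol a}$, and let $$\Sigma_{\boldsymbol a}=(\mathbb R\times\Delta_{\boldsymbol a})/\{(n,nu):n\in\mathbb Z\}$$ be the $\boldsymbol a$-adic solenoid. The characteristic function of a probability distribution $\mu$ on the Borel sets of $\Sigma_{\boldsymbol a}$ is $\hat\mu(y)=\int_{\Sigma_{\boldsymbol a}}y(x)\,d\mu(x)$, where $y$ runs over the continuous homomorphisms from $\Sigma_{\boldsymbol a}$ to the group of complex numbers of modulus $1$. The distribution $\mu$ is symmetric if $\mu(B)=\mu(-B)$ for every Borel set $B$. A probability distribution $M$ on $\mathbb R$ is a hyperbolic secant distribution if, for some real $\sigma$ (the value $\sigma=0$ being allowed), $\int_{\mathbb R}e^{isx}\,dM(x)=\dfrac{2}{e^{\sigma s}+e^{-\sigma s}}$ for all $s\in\mathbb R$. Assume that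 $\Sigma_{\boldsymbol a}$ contains an element of order $2$. Let $\alpha$ be a random variable with a Bernoulli distribution taking the values $0$ and $1$ with probability $\frac12$ each. Then, after extending the probability space of $\alpha$ if necessary, there are independent identically distributed random variables $\xi_1,\xi_2,\xi_3$ with values in $\Sigma_{\boldsymbol a}$ and with a symmetric distribution $\mu$ with nowhere vanishing characteristic function, such that $\alpha$ is independent of the random vector $(\xi_1,\xi_2,\xi_3)$ and the linear forms $2\xi_1$ and $\xi_1+\xi_2+2\alpha\xi_3$ are identically distributed, whereas $\mu$ is not of the form $\mu=\tau(M)$ (the image of $M$ under $\tau$) with $\tau:\mathbb R\to\Sigma_{\boldsymbol a}$ a continuous injective homomorphism and $M$ a hyperbolic secant distribution on $\mathbb R$. -/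

import Mathlib

open MeasureTheory ProbabilityTheory

universe u

/-- The group of `a`-adic integers. As a set it is the product of the digit sets
`{0, 1, …, a n - 1}`; addition (below) is digitwise addition with carry. -/
def AdicIntegers (a : ℕ → ℕ) : Type := (n : ℕ) → Fin (a n)

namespace AdicIntegers

variable {a : ℕ → ℕ}

/-- The product topology, each digit set being discrete. -/
instance : TopologicalSpace (AdicIntegers a) :=
  inferInstanceAs (TopologicalSpace ((n : ℕ) → Fin (a n)))

/-- The carry into position `n` when `x` and `y` are added. -/
def carry (x y : AdicIntegers a) : ℕ → ℕ
  | 0 => 0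
  | n + 1 => ((x n : ℕ) + (y n : ℕ) + carry x y n) / a n

/-- `a 0 * a 1 * ⋯ * a (n - 1)`, the weight of the digit at position `n`. -/
def weight (a : ℕ → ℕ) (n : ℕ) : ℕ := ∏ i ∈ Finset.range n, a i

/-- The number given by the first `n` digits of `x`. -/
def val (x : AdicIntegers a) (n : ℕ) : ℕ := ∑ i ∈ Finset.range n, (x i : ℕ) * weight a i

theorem val_lt [∀ n, (a n).AtLeastTwo] (x : AdicIntegers a) (n : ℕ) :
    val x n < weight a n := by
  induction n with
  | zero => simp [val, weight]
  | succ n ih =>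
    have h := (x n).isLt
    have h1 : ((x n : ℕ) + 1) * weight a n ≤ a n * weight a n := Nat.mul_le_mul_right _ h
    have h2 : val x (n + 1) = val x n + (x n : ℕ) * weight a n := by
      simp [val, Finset.sum_range_succ]
    have h3 : weight a (n + 1) = a n * weight a n := by
      simp [weight, Finset.prod_range_succ, mul_comm]
    rw [h2, h3]
    linarith

/-- Two `a`-adic integers are equal if their first `n` digits give the same residue modulo
`weight a n`, for all `n`. -/
theorem ext_val [∀ n, (a n).AtLeastTwo] {x y : AdicIntegers a}
    (h : ∀ n, (val x n : ZMod (weight a n)) = (val y n : ZMod (weight a n))) : x = y := by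
  have h' : ∀ n, val x n = val y n := fun n =>
    Nat.ModEq.eq_of_lt_of_lt ((ZMod.natCast_eq_natCast_iff _ _ _).1 (h n)) (val_lt x n) (val_lt y n)
  funext n
  have hw : 0 < weight a n := (Nat.zero_le _).trans_lt (val_lt x n)
  have h1 := h' (n + 1)
  simp only [val, Finset.sum_range_succ] at h1
  have h2 := h' n
  simp only [val] at h2
  rw [h2] at h1
  exact Fin.ext (Nat.eq_of_mul_eq_mul_right hw (Nat.add_left_cancel h1))

/-- The digitwise complement: the digit `x n` is replaced by `a n - 1 - x n`. -/
def compl (x : AdicIntegers a) : AdicIntegers a := fun n => Fin.rev (x n)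

theorem val_compl_add (x : AdicIntegers a) (n : ℕ) :
    val (compl x) n + val x n + 1 = weight a n := by
  induction n with
  | zero => simp [val, weight]
  | succ n ih =>
    have h2 : ∀ z : AdicIntegers a, val z (n + 1) = val z n + (z n : ℕ) * weight a n := by
      intro z
      simp [val, Finset.sum_range_succ]
    have h3 : weight a (n + 1) = a n * weight a n := by
      simp [weight, Finset.prod_range_succ, mul_comm]
    have h4 : ((compl x n : Fin (a n)) : ℕ) + (x n : ℕ) + 1 = a n := by
      have h := (x n).isLt
      simp only [compl, Fin.val_rev]
      omega
    rw [h2, h2, h3]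
    linear_combination ih + weight a n * h4

variable [∀ n, (a n).AtLeastTwo]

/-- The zero element `(0, 0, 0, …)`. -/
instance : Zero (AdicIntegers a) := ⟨fun _ => 0⟩

/-- Addition with carry. -/
instance : Add (AdicIntegers a) :=
  ⟨fun x y n => Fin.ofNat (a n) ((x n : ℕ) + (y n : ℕ) + carry x y n)⟩

/-- The element `u = (1, 0, 0, …)`. -/
def unit (a : ℕ → ℕ) [∀ n, (a n).AtLeastTwo] : AdicIntegers a := fun n => if n = 0 then 1 else 0

/-- Negation: the digitwise complement plus `(1, 0, 0, …)`. -/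
instance : Neg (AdicIntegers a) := ⟨fun x => compl x + unit a⟩

theorem val_add_carry (x y : AdicIntegers a) (n : ℕ) :
    val (x + y) n + carry x y n * weight a n = val x n + val y n := by
  induction n with
  | zero => simp [val, carry]
  | succ n ih =>
    have h2 : ∀ z : AdicIntegers a, val z (n + 1) = val z n + (z n : ℕ) * weight a n := by
      intro z
      simp [val, Finset.sum_range_succ]
    have h3 : weight a (n + 1) = a n * weight a n := by
      simp [weight, Finset.prod_range_succ, mul_comm]
    have h4 : (((x + y) n : Fin (a n)) : ℕ) = ((x n : ℕ) + (y n : ℕ) + carry x y n) % a n := rfl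
    have h5 : carry x y (n + 1) = ((x n : ℕ) + (y n : ℕ) + carry x y n) / a n := rfl
    have h6 := Nat.mod_add_div ((x n : ℕ) + (y n : ℕ) + carry x y n) (a n)
    rw [h2, h2, h2, h3, h4, h5]
    linear_combination ih + weight a n * h6

theorem cast_val_add (x y : AdicIntegers a) (n : ℕ) :
    (val (x + y) n : ZMod (weight a n)) = val x n + val y n := by
  have h := congrArg (Nat.cast : ℕ → ZMod (weight a n)) (val_add_carry x y n)
  simpa using h

theorem cast_val_zero (n : ℕ) : (val (0 : AdicIntegers a) n : ZMod (weight a n)) = 0 := by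
  have h : ∀ i, (((0 : AdicIntegers a) i : Fin (a i)) : ℕ) = 0 := fun i => rfl
  simp [val, h]

theorem cast_val_unit (n : ℕ) : (val (unit a) n : ZMod (weight a n)) = 1 := by
  cases n with
  | zero => exact Subsingleton.elim (α := ZMod 1) _ _
  | succ n =>
    have h0 : ((unit a 0 : Fin (a 0)) : ℕ) = 1 := by
      have h2 : 2 ≤ a 0 := Nat.AtLeastTwo.prop
      simp only [unit, if_true]
      exact Nat.mod_eq_of_lt h2
    have h : ∀ i, ((unit a (i + 1) : Fin (a (i + 1))) : ℕ) = 0 := fun i => by simp [unit]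
    have h1 : val (unit a) (n + 1) = 1 := by
      simp only [val, Finset.sum_range_succ', h0, h, weight]
      simp
    rw [h1, Nat.cast_one]

theorem cast_val_neg (x : AdicIntegers a) (n : ℕ) :
    (val (-x) n : ZMod (weight a n)) = -val x n := by
  have h := congrArg (Nat.cast : ℕ → ZMod (weight a n)) (val_compl_add x n)
  push_cast at h
  rw [ZMod.natCast_self] at h
  have h1 : (val (-x) n : ZMod (weight a n)) = val (compl x) n + val (unit a) n :=
    cast_val_add (compl x) (unit a) n
  rw [h1, cast_val_unit]
  linear_combination h

instance : AddCommGroup (AdicIntegers a) :=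
  { AddGroup.ofLeftAxioms (G := AdicIntegers a)
      (fun x y z => ext_val fun n => by simp only [cast_val_add, add_assoc])
      (fun x => ext_val fun n => by simp only [cast_val_add, cast_val_zero, zero_add])
      (fun x => ext_val fun n => by
        simp only [cast_val_add, cast_val_zero, cast_val_neg, neg_add_cancel]) with
    add_comm := fun x y => ext_val fun n => by simp only [cast_val_add, add_comm] }

end AdicIntegers

/-- The `a`-adic solenoid `(ℝ × Δ_a) / B`, where `Δ_a` is the group of `a`-adic integers and
`B = {(n, n u) : n ∈ ℤ}` is the subgroup generated by `(1, u)`, `u = (1, 0, 0, …)`. -/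
def Solenoid (a : ℕ → ℕ) [∀ n, (a n).AtLeastTwo] : Type :=
  (ℝ × AdicIntegers a) ⧸ AddSubgroup.zmultiples ((1 : ℝ), AdicIntegers.unit a)

namespace Solenoid

variable (a : ℕ → ℕ) [∀ n, (a n).AtLeastTwo]

instance : AddCommGroup (Solenoid a) :=
  inferInstanceAs (AddCommGroup
    ((ℝ × AdicIntegers a) ⧸ AddSubgroup.zmultiples ((1 : ℝ), AdicIntegers.unit a)))

/-- The quotient topology of the product topology on `ℝ × Δ_a`. -/
instance : TopologicalSpace (Solenoid a) :=
  inferInstanceAs (TopologicalSpace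
    ((ℝ × AdicIntegers a) ⧸ AddSubgroup.zmultiples ((1 : ℝ), AdicIntegers.unit a)))

/-- The Borel `σ`-algebra. -/
instance : MeasurableSpace (Solenoid a) := borel (Solenoid a)

instance : BorelSpace (Solenoid a) := ⟨rfl⟩

end Solenoid

/-- The characteristic function (Fourier transform) of a distribution on an additive group, at a
character `y` of the group: `∫ (x, y) dμ(x)`. -/
noncomputable def groupCharFun {X : Type*} [AddCommGroup X] [MeasurableSpace X]
    (μ : Measure X) (y : AddChar X Circle) : ℂ :=
  ∫ x, (y x : ℂ) ∂μ

/-- `M` is a hyperbolic secant distribution on the real line: a probability distribution with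
characteristic function `2 / (e ^ (σ s) + e ^ (-σ s))` for some real `σ`. The value `σ = 0`, that
is, the unit mass at `0`, is allowed. -/
def IsHyperbolicSecant (M : Measure ℝ) : Prop :=
  IsProbabilityMeasure M ∧
    ∃ σ : ℝ, ∀ s : ℝ, charFun M s = ((2 / (Real.exp (σ * s) + Real.exp (-(σ * s))) : ℝ) : ℂ)

/-! ### Topology of the `a`-adic integers -/

namespace AdicIntegers

variable {a : ℕ → ℕ}

/-! Take `μ` to be the law of `g + τ(η)`, where `g` has order 2, `τ` is a continuous homomorphism
from the line and `η` is hyperbolic secant. Since `2g = 0`, the shift cancels in both linear forms,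
so the claim descends to the real line (`IsHyperbolicSecant.identDistrib`), where it is the identity
`sech 2x = sech² x · (1 + sech 2x) / 2` (`sech_duplication`). Symmetry survives because `-g = g`.

At a continuous character `y` the transform of `μ` is `y g` times a positive number
(`IsHyperbolicSecant.groupCharFun_map`), hence nonzero. Characters separate points, so some `y` has
`y g = -1`, and there the transform is negative. An unshifted image `τ'(M')` has positive transform
everywhere, so `μ` is not one. -/

theorem continuous_digit (n : ℕ) : Continuous fun x : AdicIntegers a => x n :=
  continuous_apply (A := fun n => Fin (a n)) n

theorem continuous_val (n : ℕ) : Continuous fun x : AdicIntegers a => val x n :=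
  continuous_finsetSum _ fun i _ =>
    ((continuous_of_discreteTopology (f := fun d : Fin (a i) => (d : ℕ))).comp
      (continuous_digit i)).mul continuous_const

theorem continuous_compl : Continuous (compl : AdicIntegers a → AdicIntegers a) :=
  continuous_pi fun n => (continuous_of_discreteTopology (f := Fin.rev)).comp (continuous_digit n)

theorem continuous_carry (n : ℕ) :
    Continuous fun p : AdicIntegers a × AdicIntegers a => carry p.1 p.2 n := by
  induction n with
  | zero => exact continuous_const
  | succ n ih =>
    exact (continuous_of_discreteTopology
      (f := fun q : Fin (a n) × Fin (a n) × ℕ => ((q.1 : ℕ) + (q.2.1 : ℕ) + q.2.2) / a n)).comp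
      (((continuous_digit n).comp continuous_fst).prodMk
        (((continuous_digit n).comp continuous_snd).prodMk ih))

variable [∀ n, (a n).AtLeastTwo]

instance : ContinuousAdd (AdicIntegers a) where
  continuous_add := continuous_pi fun n =>
    (continuous_of_discreteTopology
      (f := fun q : Fin (a n) × Fin (a n) × ℕ =>
        Fin.ofNat (a n) ((q.1 : ℕ) + (q.2.1 : ℕ) + q.2.2))).comp
      (((continuous_digit n).comp continuous_fst).prodMk
        (((continuous_digit n).comp continuous_snd).prodMk (continuous_carry n)))

instance : IsTopologicalAddGroup (AdicIntegers a) where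
  continuous_neg := continuous_compl.add continuous_const

/-- Reduction of an `a`-adic integer modulo `weight a n`. -/
def toZMod (n : ℕ) : AdicIntegers a →+ ZMod (weight a n) where
  toFun x := val x n
  map_zero' := cast_val_zero n
  map_add' x y := cast_val_add x y n

end AdicIntegers

/-! ### Characters of the solenoid -/

namespace Solenoid

open AdicIntegers

variable {a : ℕ → ℕ} [∀ n, (a n).AtLeastTwo]

instance : IsTopologicalAddGroup (Solenoid a) :=
  inferInstanceAs (IsTopologicalAddGroup
    ((ℝ × AdicIntegers a) ⧸ AddSubgroup.zmultiples ((1 : ℝ), AdicIntegers.unit a)))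

/-- The homomorphism `(t, x) ↦ t - x` from `ℝ × Δ_a` to `ℝ / (weight a n) ℤ`. -/
noncomputable def subVal (n : ℕ) : ℝ × AdicIntegers a →+ AddCircle (weight a n : ℝ) where
  toFun p := ((p.1 - (val p.2 n : ℝ) : ℝ) : AddCircle (weight a n : ℝ))
  map_zero' := by
    have h : ∀ i, (((0 : AdicIntegers a) i : Fin (a i)) : ℕ) = 0 := fun i => rfl
    simp [val, h]
  map_add' p q := by
    rw [← AddCircle.coe_add, ← sub_eq_zero, ← AddCircle.coe_sub, AddCircle.coe_eq_zero_iff]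
    -- Truncation fails to be additive only by the carry into position `n`, and that carry counts
    -- whole periods `weight a n`.
    refine ⟨carry p.2 q.2 n, ?_⟩
    have h := congrArg (Nat.cast : ℕ → ℝ) (val_add_carry p.2 q.2 n)
    push_cast at h
    simp only [Prod.fst_add, Prod.snd_add, zsmul_eq_mul, Int.cast_natCast]
    linear_combination h

theorem continuous_subVal (n : ℕ) : Continuous (subVal (a := a) n) :=
  (AddCircle.continuous_mk' _).comp
    (continuous_fst.sub (continuous_of_discreteTopology.comp
      ((continuous_val n).comp continuous_snd)))

theorem subVal_unit (n : ℕ) : subVal n ((1 : ℝ), AdicIntegers.unit a) = 0 := by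
  have h := cast_val_unit (a := a) n
  rw [← Nat.cast_one, ZMod.natCast_eq_natCast_iff] at h
  obtain ⟨k, hk⟩ := h.dvd
  refine (AddCircle.coe_eq_zero_iff _).2 ⟨k, ?_⟩
  have hk' := congrArg (Int.cast : ℤ → ℝ) hk
  push_cast at hk'
  simp only [zsmul_eq_mul]
  linear_combination -hk'

/-- The homomorphism from the solenoid to `ℝ / (weight a n) ℤ` induced by `subVal n`. -/
noncomputable def toAddCircle (n : ℕ) : Solenoid a →+ AddCircle (weight a n : ℝ) :=
  QuotientAddGroup.lift (AddSubgroup.zmultiples ((1 : ℝ), AdicIntegers.unit a)) (subVal n)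
    (AddSubgroup.zmultiples_le.2 (subVal_unit n))

theorem continuous_toAddCircle (n : ℕ) : Continuous (toAddCircle (a := a) n) :=
  (continuous_subVal n).quotient_lift _

theorem eq_zero_of_toAddCircle {x : Solenoid a} (h : ∀ n, toAddCircle n x = 0) : x = 0 := by
  induction x using QuotientAddGroup.induction_on with
  | H p =>
  obtain ⟨t, x⟩ := p
  have h' : ∀ n, ∃ k : ℤ, k • (weight a n : ℝ) = t - val x n := fun n =>
    (AddCircle.coe_eq_zero_iff _).1 (h n)
  -- At level 0 the weight is 1 and the truncation is 0, so `t` is an integer `m`; the other levels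
  -- then force `x = m u`.
  obtain ⟨m, hm⟩ := h' 0
  have ht : t = m := by simpa [weight, val] using hm.symm
  refine (QuotientAddGroup.eq_zero_iff _).2 (AddSubgroup.mem_zmultiples_iff.2 ⟨m, ?_⟩)
  refine Prod.ext (by simp [ht]) (ext_val fun n => ?_)
  obtain ⟨k, hk⟩ := h' n
  have hk' : k * (weight a n : ℤ) = m - val x n := by
    rw [ht, zsmul_eq_mul] at hk
    exact_mod_cast hk
  have h1 : toZMod n (m • AdicIntegers.unit a) = (m : ZMod (weight a n)) := by
    rw [map_zsmul]
    change m • ((val (AdicIntegers.unit a) n : ℕ) : ZMod (weight a n)) = _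
    rw [cast_val_unit, zsmul_one]
  refine h1.trans ?_
  have h2 := congrArg (Int.cast : ℤ → ZMod (weight a n)) hk'
  push_cast at h2
  rw [ZMod.natCast_self, mul_zero] at h2
  exact (sub_eq_zero.1 h2.symm)

/-- The continuous characters of the solenoid separate points. -/
theorem exists_continuous_char_ne_one {x : Solenoid a} (hx : x ≠ 0) :
    ∃ y : AddChar (Solenoid a) Circle, Continuous y ∧ y x ≠ 1 := by
  obtain ⟨n, hn⟩ : ∃ n, toAddCircle n x ≠ 0 := by
    by_contra! h
    exact hx (eq_zero_of_toAddCircle h)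
  have hw : (weight a n : ℝ) ≠ 0 := by
    exact_mod_cast ((Nat.zero_le _).trans_lt (val_lt (0 : AdicIntegers a) n)).ne'
  refine ⟨AddCircle.toCircle_addChar.compAddMonoidHom (toAddCircle n),
    AddCircle.continuous_toCircle.comp (continuous_toAddCircle n), fun h => hn ?_⟩
  exact AddCircle.injective_toCircle hw (h.trans AddCircle.toCircle_zero.symm)

/-- The image of the real line in the solenoid. -/
def ofReal : ℝ →+ Solenoid a :=
  (QuotientAddGroup.mk' (AddSubgroup.zmultiples ((1 : ℝ), AdicIntegers.unit a))).comp
    (AddMonoidHom.inl ℝ (AdicIntegers a))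

theorem continuous_ofReal : Continuous (ofReal : ℝ →+ Solenoid a) :=
  continuous_quot_mk.comp (continuous_id.prodMk continuous_const)

end Solenoid

/-! ### Hyperbolic secant distributions on the line -/

/-- A continuous character of the real line is an exponential. -/
theorem AddChar.exists_eq_exp {ψ : AddChar ℝ Circle} (hψ : Continuous ψ) :
    ∃ r : ℝ, ∀ s : ℝ, ψ s = Circle.exp (r * s) := by
  obtain ⟨θ, ⟨h0, hθ⟩, -⟩ := Circle.isCoveringMap_exp.existsUnique_continuousMap_lifts
    (⟨ψ, hψ⟩ : C(ℝ, Circle)) 0 0 (by simp)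
  have hθ' : ∀ s, Circle.exp (θ s) = ψ s := fun s => congrFun hθ s
  have hadd : ∀ s t, θ (s + t) = θ s + θ t := fun s t => by
    -- Both sides lift the same map through the covering and agree at `s = 0`.
    refine congrFun (Circle.isCoveringMap_exp.eq_of_comp_eq (g₁ := fun s => θ (s + t))
      (g₂ := fun s => θ s + θ t) (by fun_prop) (by fun_prop) ?_ 0 (by simp [h0])) s
    funext x
    simp [Circle.exp_add, hθ', AddChar.map_add_eq_mul]
  let L : ℝ →L[ℝ] ℝ := (AddMonoidHom.mk' θ hadd).toRealLinearMap θ.continuous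
  refine ⟨θ 1, fun s => ?_⟩
  have h := L.map_smul s 1
  rw [smul_eq_mul, mul_one, smul_eq_mul] at h
  rw [← hθ' s, mul_comm]
  exact congrArg _ h

open Complex in
/-- The logit of a random variable with the arcsine distribution has the hyperbolic secant
distribution. -/
theorem charFun_map_logit_betaMeasure (t : ℝ) :
    charFun ((betaMeasure (1 / 2) (1 / 2)).map fun x => Real.log x - Real.log (1 - x)) t =
      ((2 / (Real.exp (Real.pi * t) + Real.exp (-(Real.pi * t))) : ℝ) : ℂ) := by
  have hmeas : Measurable fun x : ℝ => Real.log x - Real.log (1 - x) := by fun_prop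
  have hB : beta (1 / 2) (1 / 2) = Real.pi := by
    rw [beta, Real.Gamma_one_half_eq, add_halves, Real.Gamma_one, div_one,
      Real.mul_self_sqrt Real.pi_pos.le]
  rw [charFun_apply_real, integral_map hmeas.aemeasurable (by fun_prop), betaMeasure,
    integral_withDensity_eq_integral_toReal_smul₀ (by unfold betaPDF; fun_prop)
      (by simp [betaPDF])]
  have hint : ∀ x : ℝ, (betaPDF (1 / 2) (1 / 2) x).toReal •
      cexp (t * ((Real.log x - Real.log (1 - x) : ℝ) : ℂ) * I) =
      (Set.Ioo (0 : ℝ) 1).indicator (fun x : ℝ => (Real.pi : ℂ)⁻¹ *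
        ((x : ℂ) ^ ((1 / 2 + t * I : ℂ) - 1) * (1 - (x : ℂ)) ^ ((1 / 2 - t * I : ℂ) - 1))) x := by
    intro x
    by_cases hx : x ∈ Set.Ioo (0 : ℝ) 1
    · have h0 : 0 < x := hx.1
      have h1 : 0 < 1 - x := sub_pos.2 hx.2
      rw [Set.indicator_of_mem hx, betaPDF_of_pos_lt_one hx.1 hx.2,
        ENNReal.toReal_ofReal (by rw [hB]; have := Real.pi_pos; positivity), hB,
        cpow_def_of_ne_zero (by exact_mod_cast h0.ne'),
        show (1 - (x : ℂ)) = ((1 - x : ℝ) : ℂ) by push_cast; rfl,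
        cpow_def_of_ne_zero (by exact_mod_cast h1.ne'), ← ofReal_log h0.le, ← ofReal_log h1.le,
        Real.rpow_def_of_pos h0, Real.rpow_def_of_pos h1, real_smul]
      push_cast
      rw [one_div, mul_assoc, mul_assoc, ← Complex.exp_add, ← Complex.exp_add, ← Complex.exp_add]
      congr 2
      ring
    · rw [Set.indicator_of_notMem hx]
      rcases not_and_or.1 hx with h | h
      · rw [betaPDF_eq_zero_of_nonpos (not_lt.1 h)]; simp
      · rw [betaPDF_eq_zero_of_one_le (not_lt.1 h)]; simp
  simp_rw [hint]
  rw [integral_indicator measurableSet_Ioo, integral_const_mul, ← integral_Ioc_eq_integral_Ioo,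
    ← intervalIntegral.integral_of_le zero_le_one]
  -- The parameters sum to 1, so the Beta integral is `Γ(z) Γ(1 - z)` with `z = 1/2 + it`, which by
  -- reflection is `π / sin πz = π / cosh πt`.
  have hbeta := Gamma_mul_Gamma_eq_betaIntegral (s := 1 / 2 + t * I) (t := 1 / 2 - t * I)
    (by simp) (by simp)
  have hrefl := Gamma_mul_Gamma_one_sub (1 / 2 + t * I)
  rw [show (1 : ℂ) - (1 / 2 + t * I) = 1 / 2 - t * I by ring, hbeta,
    show (1 / 2 + t * I + (1 / 2 - t * I) : ℂ) = 1 by ring, Gamma_one, one_mul,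
    show (Real.pi : ℂ) * (1 / 2 + t * I) = (Real.pi * t) * I + Real.pi / 2 by ring,
    Complex.sin_add_pi_div_two, cos_mul_I] at hrefl
  rw [betaIntegral] at hrefl
  rw [hrefl, Complex.cosh]
  have hpi : (Real.pi : ℂ) ≠ 0 := by exact_mod_cast Real.pi_ne_zero
  push_cast
  field_simp

/-- Supplies `η` with `σ = π`; for `σ = 0` the shifted law would be just a point mass at `g`. -/
theorem exists_nondegenerate_isHyperbolicSecant :
    ∃ M : Measure ℝ, IsProbabilityMeasure M ∧ ∀ t : ℝ, charFun M t =
      ((2 / (Real.exp (Real.pi * t) + Real.exp (-(Real.pi * t))) : ℝ) : ℂ) := by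
  have hbeta := isProbabilityMeasureBeta (one_half_pos (α := ℝ)) (one_half_pos (α := ℝ))
  exact ⟨_, Measure.isProbabilityMeasure_map (by fun_prop), charFun_map_logit_betaMeasure⟩

/-- With `p = e^x` and `q = e^(-x)`, it reduces to `(p + q)² = p² + q² + 2`, as `pq = 1`. -/
theorem sech_duplication (x : ℝ) :
    2 / (Real.exp (2 * x) + Real.exp (-(2 * x))) =
      (2 / (Real.exp x + Real.exp (-x))) ^ 2 *
        (1 / 2 + 1 / 2 * (2 / (Real.exp (2 * x) + Real.exp (-(2 * x))))) := by
  have h1 : Real.exp (2 * x) = Real.exp x ^ 2 := by rw [← Real.exp_nat_mul]; norm_num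
  have h2 : Real.exp (-(2 * x)) = Real.exp (-x) ^ 2 := by
    rw [← Real.exp_nat_mul]; congr 1; push_cast; ring
  have h3 : Real.exp x * Real.exp (-x) = 1 := by rw [← Real.exp_add]; simp
  have := Real.exp_pos x
  have := Real.exp_pos (-x)
  rw [h1, h2]
  generalize Real.exp x = p at *
  generalize Real.exp (-x) = q at *
  have h4 : (p + q) ^ 2 = p ^ 2 + q ^ 2 + 2 := by linear_combination 2 * h3
  rw [div_pow, h4]
  field_simp

/-- A hyperbolic secant distribution on the real line is symmetric. -/
theorem IsHyperbolicSecant.map_neg {M : Measure ℝ} (hM : IsHyperbolicSecant M) :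
    M.map (fun s => -s) = M := by
  have := hM.1
  obtain ⟨σ, hσ⟩ := hM.2
  have : IsProbabilityMeasure (M.map fun s : ℝ => -s) :=
    Measure.isProbabilityMeasure_map measurable_neg.aemeasurable
  refine Measure.ext_of_charFun (funext fun t => ?_)
  have h : charFun (M.map fun s : ℝ => -s) t = charFun M (-t) := by
    rw [charFun_apply_real, charFun_apply_real,
      integral_map measurable_neg.aemeasurable (by fun_prop)]
    simp
  rw [h, hσ, hσ]
  simp [add_comm]

/-- For `η₁, η₂, η₃` independent with the same hyperbolic secant distribution and `α` an
independent Bernoulli variable, `2 η₁` and `η₁ + η₂ + 2 α η₃` are identically distributed. -/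
theorem IsHyperbolicSecant.identDistrib {M : Measure ℝ} (hM : IsHyperbolicSecant M)
    {Ω₀ : Type u} [MeasurableSpace Ω₀] (P₀ : Measure Ω₀) [IsProbabilityMeasure P₀]
    (α : Ω₀ → ℕ) (hα : Measurable α)
    (hα_zero : P₀ {ω | α ω = 0} = 1 / 2) (hα_one : P₀ {ω | α ω = 1} = 1 / 2) :
    IdentDistrib (fun ω : Ω₀ × (Fin 3 → ℝ) => 2 * ω.2 0)
      (fun ω : Ω₀ × (Fin 3 → ℝ) => ω.2 0 + ω.2 1 + (2 * α ω.1 : ℕ) * ω.2 2)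
      (P₀.prod (Measure.pi fun _ => M)) (P₀.prod (Measure.pi fun _ => M)) := by
  have := hM.1
  obtain ⟨σ, hσ⟩ := hM.2
  have hα' : Measurable fun ω : Ω₀ × (Fin 3 → ℝ) => ((2 * α ω.1 : ℕ) : ℝ) :=
    (measurable_from_nat (f := fun n => ((2 * n : ℕ) : ℝ))).comp (hα.comp measurable_fst)
  have hm1 : Measurable fun ω : Ω₀ × (Fin 3 → ℝ) => 2 * ω.2 0 := by fun_prop
  have hm2 : Measurable fun ω : Ω₀ × (Fin 3 → ℝ) =>
    ω.2 0 + ω.2 1 + (2 * α ω.1 : ℕ) * ω.2 2 := by fun_prop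
  refine ⟨hm1.aemeasurable, hm2.aemeasurable, ?_⟩
  have := Measure.isProbabilityMeasure_map (μ := P₀.prod (Measure.pi fun _ => M)) hm1.aemeasurable
  have := Measure.isProbabilityMeasure_map (μ := P₀.prod (Measure.pi fun _ => M)) hm2.aemeasurable
  refine Measure.ext_of_charFun (funext fun t => ?_)
  have hprod : ∀ c : Fin 3 → ℝ, ∫ x : Fin 3 → ℝ,
      Complex.exp (t * ((c 0 * x 0 + c 1 * x 1 + c 2 * x 2 : ℝ) : ℂ) * Complex.I)
        ∂(Measure.pi fun _ => M) =
      charFun M (c 0 * t) * charFun M (c 1 * t) * charFun M (c 2 * t) := by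
    intro c
    simp_rw [charFun_apply_real]
    rw [← Fin.prod_univ_three (f := fun i => ∫ x : ℝ, Complex.exp ((c i * t : ℝ) * x * Complex.I) ∂M),
      ← integral_fintype_prod_eq_prod
        (f := fun i (x : ℝ) => Complex.exp ((c i * t : ℝ) * (x : ℂ) * Complex.I))]
    refine integral_congr_ae (.of_forall fun x => ?_)
    simp only [Fin.prod_univ_three, ← Complex.exp_add]
    congr 1
    push_cast
    ring
  have hone : charFun M 0 = 1 := by simp
  have hbern : ∀ g : ℕ → ℂ, ∫ ω, g (α ω) ∂P₀ = 1 / 2 * g 0 + 1 / 2 * g 1 := by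
    intro g
    have hs0 : MeasurableSet {ω | α ω = 0} := hα (measurableSet_singleton 0)
    have hs1 : MeasurableSet {ω | α ω = 1} := hα (measurableSet_singleton 1)
    have hdisj : Disjoint {ω | α ω = 0} {ω | α ω = 1} :=
      Set.disjoint_left.2 fun ω h0 h1 => by simp_all
    have hfull : ∀ᵐ ω ∂P₀, ω ∈ {ω | α ω = 0} ∪ {ω | α ω = 1} := by
      refine (mem_ae_iff_prob_eq_one (hs0.union hs1)).2 ?_
      rw [measure_union hdisj hs1, hα_zero, hα_one,
        ENNReal.add_halves]
    have hae : (fun ω => g (α ω)) =ᵐ[P₀] fun ω =>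
        {ω | α ω = 0}.indicator (fun _ => g 0) ω + {ω | α ω = 1}.indicator (fun _ => g 1) ω := by
      filter_upwards [hfull] with ω hω
      rcases hω with h | h <;> simp_all
    rw [integral_congr_ae hae, integral_add ((integrable_const _).indicator hs0)
      ((integrable_const _).indicator hs1), integral_indicator_const _ hs0,
      integral_indicator_const _ hs1, measureReal_def, measureReal_def, hα_zero, hα_one]
    simp
  have hbound : ∀ {f : Ω₀ × (Fin 3 → ℝ) → ℝ}, Measurable f →
      Integrable (fun ω => Complex.exp (t * (f ω : ℂ) * Complex.I))
        (P₀.prod (Measure.pi fun _ => M)) := by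
    intro f hf
    refine .of_bound (by fun_prop) 1 (.of_forall fun ω => ?_)
    rw [← Complex.ofReal_mul, Complex.norm_exp_ofReal_mul_I]
  rw [charFun_apply_real, charFun_apply_real, integral_map hm1.aemeasurable (by fun_prop),
    integral_map hm2.aemeasurable (by fun_prop), integral_prod _ (hbound hm1),
    integral_prod _ (hbound hm2)]
  -- The coefficient vectors of the two forms, the second with `α` frozen at `n`; averaging over `α`
  -- comes afterwards.
  have h1 := hprod ![2, 0, 0]
  have h2 := fun n : ℕ => hprod ![1, 1, (2 * n : ℕ)]
  simp only [Matrix.cons_val, zero_mul, add_zero, hone, mul_one, one_mul] at h1 h2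
  simp only [h1, h2]
  rw [hbern fun n => charFun M t * charFun M t * charFun M ((2 * n : ℕ) * t)]
  simp only [mul_zero, Nat.cast_zero, zero_mul, hone, mul_one, integral_const, probReal_univ,
    one_smul, Nat.cast_ofNat]
  rw [hσ, hσ, show σ * (2 * t) = 2 * (σ * t) by ring]
  conv_lhs => rw [sech_duplication]
  push_cast
  ring

/-! ### Shifted images in a topological group -/

section Shift

variable {X : Type*} [AddCommGroup X] [TopologicalSpace X] [IsTopologicalAddGroup X]
  [MeasurableSpace X] [BorelSpace X]

/-- At a continuous character `y`, the characteristic function of the shift by `g` of the image of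
a hyperbolic secant distribution is a positive multiple of `y g`. -/
theorem IsHyperbolicSecant.groupCharFun_map {M : Measure ℝ} (hM : IsHyperbolicSecant M)
    {τ : ℝ →+ X} (hτ : Continuous τ) (g : X) {y : AddChar X Circle} (hy : Continuous y) :
    ∃ c : ℝ, 0 < c ∧ groupCharFun (M.map fun s => g + τ s) y = y g * c := by
  have := hM.1
  obtain ⟨σ, hσ⟩ := hM.2
  -- Pulled back along `τ`, `y` becomes a frequency `r`, so the positive factor is the transform of
  -- `M` at `r`.
  obtain ⟨r, hr⟩ := AddChar.exists_eq_exp (ψ := y.compAddMonoidHom τ) (hy.comp hτ)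
  refine ⟨2 / (Real.exp (σ * r) + Real.exp (-(σ * r))), by positivity, ?_⟩
  have hm : Measurable fun s => g + τ s := (continuous_const.add hτ).measurable
  rw [groupCharFun, integral_map hm.aemeasurable
    (Continuous.measurable (by fun_prop)).aestronglyMeasurable, ← hσ, charFun_apply_real,
    ← integral_const_mul]
  refine integral_congr_ae (.of_forall fun s => ?_)
  have hs : y (τ s) = Circle.exp (r * s) := hr s
  simp only [AddChar.map_add_eq_mul, hs, Circle.coe_mul, Circle.coe_exp, Complex.ofReal_mul]

theorem IsHyperbolicSecant.map_shift_symmetric {M : Measure ℝ} (hM : IsHyperbolicSecant M)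
    {τ : ℝ →+ X} (hτ : Continuous τ) {g : X} (hg : 2 • g = 0) {B : Set X}
    (hB : MeasurableSet B) :
    M.map (fun s => g + τ s) B = M.map (fun s => g + τ s) ((fun x => -x) ⁻¹' B) := by
  have hm : Measurable fun s => g + τ s := (continuous_const.add hτ).measurable
  have hneg : -g = g := neg_eq_of_add_eq_zero_left (by rw [← two_nsmul, hg])
  rw [Measure.map_apply hm hB, Measure.map_apply hm (continuous_neg.measurable hB)]
  conv_lhs => rw [← hM.map_neg, Measure.map_apply measurable_neg (hm hB)]
  congr 1
  ext s
  simp [hneg, add_comm]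

end Shift

/-! ### The counterexample -/

theorem proposition2p7 (a : ℕ → ℕ) [∀ j, (a j).AtLeastTwo]
    (h_two : ∃ g : Solenoid a, addOrderOf g = 2)
    {Ω₀ : Type u} [MeasurableSpace Ω₀] (P₀ : Measure Ω₀) [IsProbabilityMeasure P₀]
    (α : Ω₀ → ℕ) (hα : Measurable α)
    (hα_zero : P₀ {ω | α ω = 0} = 1 / 2) (hα_one : P₀ {ω | α ω = 1} = 1 / 2) :
    ∃ (μ : Measure (Solenoid a)),
      IsProbabilityMeasure μ ∧
      -- `μ` is symmetric, with nonvanishing characteristic function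
      (∀ B : Set (Solenoid a), MeasurableSet B → μ B = μ ((fun x => -x) ⁻¹' B)) ∧
      (∀ y : AddChar (Solenoid a) Circle, Continuous y → groupCharFun μ y ≠ 0) ∧
      -- on some extension `π : Ω → Ω₀` of the probability space of `α` there are `ξ₁, ξ₂, ξ₃`
      (∃ (Ω : Type u) (_ : MeasurableSpace Ω) (P : Measure Ω) (π : Ω → Ω₀)
          (ξ₁ ξ₂ ξ₃ : Ω → Solenoid a),
        IsProbabilityMeasure P ∧ MeasurePreserving π P P₀ ∧
        Measurable ξ₁ ∧ Measurable ξ₂ ∧ Measurable ξ₃ ∧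
        P.map ξ₁ = μ ∧ P.map ξ₂ = μ ∧ P.map ξ₃ = μ ∧
        iIndepFun ![ξ₁, ξ₂, ξ₃] P ∧
        IndepFun (fun ω => α (π ω)) (fun ω => (ξ₁ ω, ξ₂ ω, ξ₃ ω)) P ∧
        IdentDistrib (fun ω => 2 • ξ₁ ω)
          (fun ω => ξ₁ ω + ξ₂ ω + (2 * α (π ω)) • ξ₃ ω) P P) ∧
      -- `μ` is not of the form `τ(M)`
      ¬ ∃ (τ : ℝ →+ Solenoid a) (M : Measure ℝ), Continuous τ ∧ Function.Injective τ ∧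
          IsHyperbolicSecant M ∧ μ = M.map τ := by
  obtain ⟨g, hg⟩ := h_two
  have hg2 : 2 • g = 0 := hg ▸ addOrderOf_nsmul_eq_zero g
  have hg0 : g ≠ 0 := by rintro rfl; simp at hg
  obtain ⟨M, hMp, hMc⟩ := exists_nondegenerate_isHyperbolicSecant
  have hM : IsHyperbolicSecant M := ⟨hMp, Real.pi, hMc⟩
  have hτ := Solenoid.continuous_ofReal (a := a)
  generalize (Solenoid.ofReal : ℝ →+ Solenoid a) = τ at hτ
  have hm : Measurable fun s => g + τ s := (continuous_const.add hτ).measurable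
  have hcoord : ∀ i : Fin 3, (P₀.prod (Measure.pi fun _ : Fin 3 => M)).map
      (fun ω => g + τ (ω.2 i)) = M.map fun s => g + τ s := fun i => by
    have h : MeasurePreserving (fun ω : Ω₀ × (Fin 3 → ℝ) => ω.2 i)
        (P₀.prod (Measure.pi fun _ : Fin 3 => M)) M :=
      (measurePreserving_eval (fun _ : Fin 3 => M) i).comp measurePreserving_snd
    conv_rhs => rw [← h.map_eq]
    rw [Measure.map_map hm h.measurable]
    rfl
  have hξm : ∀ i : Fin 3, Measurable fun ω : Ω₀ × (Fin 3 → ℝ) => g + τ (ω.2 i) := fun i =>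
    hm.comp (by fun_prop)
  refine ⟨M.map fun s => g + τ s, Measure.isProbabilityMeasure_map hm.aemeasurable,
    fun B hB => hM.map_shift_symmetric hτ hg2 hB, fun y hy => ?_,
    ⟨Ω₀ × (Fin 3 → ℝ), inferInstance, P₀.prod (Measure.pi fun _ => M), Prod.fst,
      fun ω => g + τ (ω.2 0), fun ω => g + τ (ω.2 1), fun ω => g + τ (ω.2 2), inferInstance,
      measurePreserving_fst, hξm 0, hξm 1, hξm 2, hcoord 0, hcoord 1, hcoord 2, ?_, ?_, ?_⟩, ?_⟩
  · obtain ⟨c, hc, h⟩ := hM.groupCharFun_map hτ g hy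
    rw [h]
    exact mul_ne_zero (Circle.coe_ne_zero _) (by exact_mod_cast hc.ne')
  · have h : ![fun ω : Ω₀ × (Fin 3 → ℝ) => g + τ (ω.2 0), fun ω => g + τ (ω.2 1),
        fun ω => g + τ (ω.2 2)] = fun i ω => g + τ (ω.2 i) := by
      funext i
      fin_cases i <;> rfl
    rw [h, iIndepFun_iff_map_fun_eq_pi_map fun i => (hξm i).aemeasurable]
    simp only [hcoord]
    rw [← Measure.pi_map_pi fun _ => hm.aemeasurable]
    conv_rhs => rw [← (measurePreserving_snd (μ := P₀) (ν := Measure.pi fun _ : Fin 3 => M)).map_eq]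
    rw [Measure.map_map (by fun_prop) measurable_snd]
    rfl
  · have hc : ∀ i : Fin 3, Measurable fun x : Fin 3 → ℝ => g + τ (x i) := fun i =>
      hm.comp (measurable_pi_apply i)
    exact indepFun_prod hα ((hc 0).prodMk ((hc 1).prodMk (hc 2)))
  -- Push the real identity through `τ`; every `g` in the two forms occurs an even number of times
  -- in total.
  · have h := (hM.identDistrib P₀ α hα hα_zero hα_one).comp hτ.measurable
    convert h using 1
    · funext ω
      rw [Function.comp_apply, nsmul_add, hg2, zero_add, ← map_nsmul, nsmul_eq_mul, Nat.cast_ofNat]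
    · funext ω
      rw [Function.comp_apply, nsmul_add, mul_comm 2 (α ω.1), mul_nsmul', hg2, nsmul_zero,
        zero_add, ← map_nsmul, map_add, map_add, nsmul_eq_mul, add_add_add_comm, ← two_nsmul, hg2,
        zero_add]
  · rintro ⟨τ', M', hτ', -, hM', h⟩
    obtain ⟨y, hy, hyg⟩ := Solenoid.exists_continuous_char_ne_one hg0
    have hsq : (y g : ℂ) ^ 2 = 1 := by
      have h1 : y (2 • g) = y g ^ 2 := AddChar.map_nsmul_eq_pow y 2 g
      rw [hg2, AddChar.map_zero_eq_one] at h1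
      exact_mod_cast congrArg (Subtype.val) h1.symm
    have hneg : (y g : ℂ) = -1 := (sq_eq_one_iff.1 hsq).resolve_left fun h => hyg (Circle.ext h)
    obtain ⟨c, hc, h1⟩ := hM.groupCharFun_map hτ g hy
    obtain ⟨c', hc', h2⟩ := hM'.groupCharFun_map hτ' 0 hy
    -- The image `τ'(M')` is the shift by 0, so its transform at `y` is `c' > 0`, against `-c < 0`
    -- for `μ`.
    simp only [zero_add] at h2
    rw [h, h2, hneg, AddChar.map_zero_eq_one, Circle.coe_one, one_mul] at h1
    have h3 : c' = -1 * c := by exact_mod_cast h1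
    linarith
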